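/- Throughout, $V$ is a finite set, $\mathcal M=(V,\mathcal I)$ is a matroid of rank $r$, accessible only through an independence oracle (which, for $S\subseteq V$, answers whether $S\in\mathcal I$), $\mathbf 1_B\in\{0,1\}^V$ is the characteristic vector of $B\subseteq V$, and $\log^+ y=\max\{0,\log y\}$ for $y>0$, $\log^+0=0$. A function $f\colon 2^V\to\mathbb R_{\ge 0}$ is submodular if $f(A)+f(B)\ge f(A\cup B)+f(A\cap B)$ for all $A,B\subseteq V$, and its multilinear extension is $F(x)=\sum_{S\subseteq V} f(S)\prod_{v\in S}x_v\prod_{v\in V\setminus S}(1-x_v)$, $x\in[0,1]^V$. There is an absolute constant $C>0$ such that for every $\varepsilon>0$ there is a randomized adaptive query algorithm with the following properties. Its input consists of a matroid $\mathcal M$ given by an independence oracle and a point $x=\sum_{i=1}^t\beta_i\mathbf 1_{B_i}$ of the base polytope of $\mathcal M$, given by bases $B_1,\dots,B_t$ of $\mathcal M$ and coefficients $\beta_1,\dots,\beta_t\ge 0$ with $\sum_{i=1}^t\beta_i=1$. On every such input: 1. its output $S$ is always a basis of $\mathcal M$; 2. $\mathbb E[f(S)]\ge(1-\varepsilon)F(x)$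 for every non-negative submodular function $f\colon 2^V\to\mathbb R_{\ge 0}$ with multilinear extension $F$; 3. it always makes at most $C\,r^{3/2}\,t\,\bigl(\log^+\frac{rt}{\varepsilon}\bigr)^{3/2}$ independence oracle queries. The algorithm does not know $f$: the distribution of $S$ does not depend on it. -/

import Mathlib

open scoped BigOperators Classical

universe u

/-- A randomized algorithm with query access to a set oracle on the subsets of `V`, as an adaptive
decision tree: it may stop with an output, ask the oracle about a subset and continue
according to the yes/no answer, or make a random draw (fresh, independent randomness) from any
distribution on a finite set and continue according to its result. -/
inductive QueryAlg (V : Type u) (α : Type u) : Type u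
  | ret (a : α) : QueryAlg V α
  | query (S : Finset V) (next : Bool → QueryAlg V α) : QueryAlg V α
  | draw {k : ℕ} (p : PMF (Fin k)) (next : Fin k → QueryAlg V α) : QueryAlg V α

namespace QueryAlg

variable {V α : Type u}

/-- The joint law of the output and the number of oracle queries made, when the oracle
is `O`. Only `query` nodes are counted. -/
noncomputable def run (O : Finset V → Bool) : QueryAlg V α → PMF (α × ℕ)
  | ret a => PMF.pure (a, 0)
  | query S next => (run O (next (O S))).map fun z => (z.1, z.2 + 1)
  | draw p next => p.bind fun i => run O (next i)

/-- The law of the output. -/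
noncomputable def output (O : Finset V → Bool) (A : QueryAlg V α) : PMF α :=
  (A.run O).map Prod.fst

end QueryAlg

/-- The independence oracle of a matroid. -/
noncomputable def indepOracle {V : Type u} (M : Matroid V) (S : Finset V) : Bool :=
  decide (M.Indep (S : Set V))

/-- The rank of a matroid as a natural number (used for finite matroids only). -/
noncomputable def matroidRank {V : Type u} (M : Matroid V) : ℕ := M.eRank.toNat

/-- Submodularity of a set function. -/
def IsSubmodular {V : Type u} (f : Finset V → ℝ) : Prop :=
  ∀ A B : Finset V, f (A ∪ B) + f (A ∩ B) ≤ f A + f B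

/-- The multilinear extension of a set function. -/
noncomputable def multilinearExt {V : Type u} [Fintype V] (f : Finset V → ℝ) (x : V → ℝ) : ℝ :=
  ∑ S : Finset V, f S * ((∏ v ∈ S, x v) * ∏ v ∈ Finset.univ \ S, (1 - x v))

/-- The characteristic vector of a set. -/
noncomputable def charVec {V : Type u} (S : Finset V) : V → ℝ := fun v => if v ∈ S then 1 else 0

/-- The expectation of a function of a random subset of a finite set. -/
noncomputable def expect {V : Type u} [Fintype V] (P : PMF (Finset V)) (f : Finset V → ℝ) : ℝ :=
  ∑ S : Finset V, (P S).toReal * f S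

/-! The method is swap rounding, with the swaps found by random sampling. Bases are merged one after
another: two bases X, Y of weights a, b are changed by random swaps until they agree. Suppose that φ
permutes a nonempty Z ⊆ X \ Y, that σ maps Z into Y \ X, and that X - φ u + σ u and Y - σ u + u are
bases for all u ∈ Z (`IsExchangeCycle`). Take u ∈ Z uniformly, and make the first swap with
probability b/(a+b), otherwise the second. The mean displacement of the point is a multiple of the
sum of e_u - e_{φ u} over Z, which is zero. By submodularity F is convex along every direction e_v -
e_u, with supporting lines given by a single gradient, so F does not drop in expectation
(`le_mean_randomSwap`), while |X \ Y| drops by one. A merge thus takes at most r steps.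

Whether v can replace some element of D in X is one query, on (X \ D) + v, so replaceable elements
are found by binary search. To find Z, draw a sample R of s elements of X \ Y. For each u ∈ R find v
such that Y - v + u is a base. If every such v can replace some w ∈ R in X, then u ↦ w maps R to
itself and permutes a nonempty Z ⊆ R. Otherwise some v can replace no element of R; unless the
sample is unlucky, v can replace at most d elements of X \ Y, and enumerating them reveals a
symmetric exchange, which is a cycle with one u (`sat_cycleSearch`).

By a union bound a sample is unlucky with probability at most r exp(-ds/r)
(`card_not_hitsLarge_le`). For s = d ≈ √(2rΛ), Λ = log⁺(rt/ε), this is at most ε/(rt); since f ≥ 0,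
the r(t-1) steps lose at most a factor 1 - ε. A step costs O(s log r) queries. -/

/-! ### Calculus of query algorithms: worst-case guarantees and expectations -/

namespace QueryAlg

variable {V α β : Type u}

/-- Sequential composition. -/
def bind : QueryAlg V α → (α → QueryAlg V β) → QueryAlg V β
  | ret a, k => k a
  | query S next, k => query S fun b => bind (next b) k
  | draw p next, k => draw p fun i => bind (next i) k

/-- `A.Sat O Q`: every branch that `A` can take against the oracle `O` ends with an output `a`
after `n` queries such that `Q a n`. -/
def Sat (O : Finset V → Bool) : QueryAlg V α → (α → ℕ → Prop) → Prop
  | ret a, Q => Q a 0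
  | query S next, Q => Sat O (next (O S)) fun a n => Q a (n + 1)
  | draw _ next, Q => ∀ i, Sat O (next i) Q

/-- The expectation of `g` at the output of the algorithm. -/
noncomputable def mean (O : Finset V → Bool) (g : α → ℝ) : QueryAlg V α → ℝ
  | ret a => g a
  | query S next => mean O g (next (O S))
  | draw p next => ∑ i, (p i).toReal * mean O g (next i)

variable {O : Finset V → Bool}

theorem Sat.mono {A : QueryAlg V α} {Q Q' : α → ℕ → Prop} (h : A.Sat O Q)
    (hQ : ∀ a n, Q a n → Q' a n) : A.Sat O Q' := by
  induction A generalizing Q Q' with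
  | ret a => exact hQ _ _ h
  | query S next ih => exact ih _ h fun a n => hQ a (n + 1)
  | draw p next ih => exact fun i => ih i (h i) hQ

theorem Sat.bind {A : QueryAlg V α} {k : α → QueryAlg V β} {Q : α → ℕ → Prop}
    {Q' : β → ℕ → Prop} (h : A.Sat O Q)
    (hk : ∀ a n, Q a n → (k a).Sat O fun b m => Q' b (n + m)) : (A.bind k).Sat O Q' := by
  induction A generalizing Q Q' with
  | ret a => exact (hk a 0 h).mono fun b m hm => by simpa using hm
  | query S next ih =>
    refine ih _ h fun a n hn => (hk a (n + 1) hn).mono fun b m hm => ?_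
    rwa [show n + m + 1 = n + 1 + m by omega]
  | draw p next ih => exact fun i => ih i (h i) hk

theorem Sat.of_mem_support {A : QueryAlg V α} {Q : α → ℕ → Prop} (h : A.Sat O Q) :
    ∀ z ∈ (A.run O).support, Q z.1 z.2 := by
  induction A generalizing Q with
  | ret a =>
    intro z hz
    simp only [run, PMF.support_pure, Set.mem_singleton_iff] at hz
    subst hz
    exact h
  | query S next ih =>
    intro z hz
    simp only [run, PMF.support_map, Set.mem_image] at hz
    obtain ⟨w, hw, rfl⟩ := hz
    exact ih _ h w hw
  | draw p next ih =>
    intro z hz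
    simp only [run, PMF.mem_support_bind_iff] at hz
    obtain ⟨i, -, hi⟩ := hz
    exact ih i (h i) z hi

theorem mean_bind (A : QueryAlg V α) (k : α → QueryAlg V β) (g : β → ℝ) :
    (A.bind k).mean O g = A.mean O fun a => (k a).mean O g := by
  induction A with
  | ret a => rfl
  | query S next ih => exact ih _
  | draw p next ih => simp only [bind, mean, ih]

theorem sum_toReal_pmf {k : ℕ} (p : PMF (Fin k)) : ∑ i, (p i).toReal = 1 := by
  have h := p.tsum_coe
  rw [tsum_fintype] at h
  rw [← ENNReal.toReal_sum fun i _ => p.apply_ne_top i, h, ENNReal.toReal_one]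

/-- Outputs need comparing only where `Q` holds, so worst-case guarantees can be used inside
expectations. -/
theorem mean_mono {A : QueryAlg V α} {Q : α → ℕ → Prop} {g g' : α → ℝ} (h : A.Sat O Q)
    (hg : ∀ a n, Q a n → g a ≤ g' a) : A.mean O g ≤ A.mean O g' := by
  induction A generalizing Q with
  | ret a => exact hg a 0 h
  | query S next ih => exact ih _ h fun a n => hg a (n + 1)
  | draw p next ih =>
    exact Finset.sum_le_sum fun i _ =>
      mul_le_mul_of_nonneg_left (ih i (h i) hg) ENNReal.toReal_nonneg

theorem mean_const (A : QueryAlg V α) (c : ℝ) : A.mean O (fun _ => c) = c := by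
  induction A with
  | ret a => rfl
  | query S next ih => exact ih _
  | draw p next ih => simp only [mean, ih, ← Finset.sum_mul, sum_toReal_pmf, one_mul]

theorem le_mean {A : QueryAlg V α} {Q : α → ℕ → Prop} {g : α → ℝ} {c : ℝ} (h : A.Sat O Q)
    (hg : ∀ a n, Q a n → c ≤ g a) : c ≤ A.mean O g :=
  (A.mean_const c).symm.le.trans (mean_mono h hg)

theorem mean_const_mul (A : QueryAlg V α) (c : ℝ) (g : α → ℝ) :
    A.mean O (fun a => c * g a) = c * A.mean O g := by
  induction A with
  | ret a => rfl
  | query S next ih => exact ih _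
  | draw p next ih => simp only [mean, ih, Finset.mul_sum]; congr! 1; ring

theorem output_query (S : Finset V) (next : Bool → QueryAlg V α) :
    (query S next).output O = (next (O S)).output O := by
  simp only [output, run, PMF.map_comp]
  rfl

theorem output_draw {k : ℕ} (p : PMF (Fin k)) (next : Fin k → QueryAlg V α) :
    (draw p next).output O = p.bind fun i => (next i).output O := by
  simp only [output, run, PMF.map_bind]

theorem expect_output [Fintype V] (A : QueryAlg V (Finset V)) (f : Finset V → ℝ) :
    expect (A.output O) f = A.mean O f := by
  induction A with
  | ret a =>
    simp only [expect, output, run, PMF.pure_map, PMF.pure_apply, mean]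
    rw [Finset.sum_eq_single a] <;> simp +contextual
  | query S next ih => rw [output_query, ih]; rfl
  | draw p next ih =>
    simp only [mean, ← ih, expect, output_draw, PMF.bind_apply, tsum_fintype, Finset.mul_sum]
    rw [Finset.sum_comm]
    refine Finset.sum_congr rfl fun S _ => ?_
    rw [ENNReal.toReal_sum fun i _ => ENNReal.mul_ne_top (p.apply_ne_top i)
      (PMF.apply_ne_top _ _), Finset.sum_mul]
    refine Finset.sum_congr rfl fun i _ => ?_
    rw [ENNReal.toReal_mul, mul_assoc]

/-- A uniform draw from a nonempty finite set. -/
noncomputable def uniform {γ : Type*} (s : Finset γ) (hs : s.Nonempty) (k : γ → QueryAlg V α) :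
    QueryAlg V α :=
  haveI : Nonempty (Fin s.card) := ⟨⟨0, hs.card_pos⟩⟩
  draw (PMF.uniformOfFintype (Fin s.card)) fun i => k (s.equivFin.symm i)

theorem Sat.uniform {γ : Type*} {s : Finset γ} (hs : s.Nonempty) {k : γ → QueryAlg V α}
    {Q : α → ℕ → Prop} (h : ∀ a ∈ s, (k a).Sat O Q) : (uniform s hs k).Sat O Q :=
  fun _ => h _ (Subtype.coe_prop _)

theorem mean_uniform {γ : Type*} {s : Finset γ} (hs : s.Nonempty) (k : γ → QueryAlg V α)
    (g : α → ℝ) : (uniform s hs k).mean O g = (∑ a ∈ s, (k a).mean O g) / s.card := by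
  simp only [QueryAlg.uniform, mean, PMF.uniformOfFintype_apply, Fintype.card_fin,
    ENNReal.toReal_inv, ENNReal.toReal_natCast, ← Finset.mul_sum]
  rw [s.equivFin.symm.sum_comp (fun a : s => (k a).mean O g),
    Finset.sum_coe_sort s (fun a => (k a).mean O g), div_eq_inv_mul]

/-- A biased coin flip: the first alternative is taken with probability `p`. -/
noncomputable def coin (p : ℝ) (hp0 : 0 ≤ p) (hp1 : p ≤ 1) (A B : QueryAlg V α) :
    QueryAlg V α :=
  draw (PMF.ofFintype ![ENNReal.ofReal p, ENNReal.ofReal (1 - p)] (by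
    rw [Fin.sum_univ_two]
    simp [← ENNReal.ofReal_add hp0 (sub_nonneg.2 hp1)])) ![A, B]

theorem Sat.coin {p : ℝ} {hp0 : 0 ≤ p} {hp1 : p ≤ 1} {A B : QueryAlg V α} {Q : α → ℕ → Prop}
    (hA : A.Sat O Q) (hB : B.Sat O Q) : (coin p hp0 hp1 A B).Sat O Q := by
  intro i
  fin_cases i
  · exact hA
  · exact hB

theorem mean_coin {p : ℝ} {hp0 : 0 ≤ p} {hp1 : p ≤ 1} {A B : QueryAlg V α} (g : α → ℝ) :
    (coin p hp0 hp1 A B).mean O g = p * A.mean O g + (1 - p) * B.mean O g := by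
  simp [QueryAlg.coin, mean, Fin.sum_univ_two, hp0, hp1]

end QueryAlg

/-! ### Convexity of the multilinear extension along exchange directions -/

/-- The multilinear extension of `f` restricted to the subsets of `s`. -/
noncomputable def partialExt {V : Type u} (s : Finset V) (f : Finset V → ℝ) (x : V → ℝ) : ℝ :=
  ∑ S ∈ s.powerset, f S * ((∏ v ∈ S, x v) * ∏ v ∈ s \ S, (1 - x v))

section partialExt
variable {V : Type u} {s : Finset V} {f g : Finset V → ℝ} {x y : V → ℝ}

theorem partialExt_congr (h : ∀ v ∈ s, x v = y v) : partialExt s f x = partialExt s f y := by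
  refine Finset.sum_congr rfl fun S hS => ?_
  rw [Finset.mem_powerset] at hS
  rw [Finset.prod_congr rfl fun v hv => h v (hS hv), Finset.prod_congr (s₁ := s \ S) rfl
    fun v hv => by rw [h v (Finset.mem_sdiff.1 hv).1]]

theorem partialExt_sub : partialExt s (fun S => f S - g S) x =
    partialExt s f x - partialExt s g x := by
  simp only [partialExt, sub_mul, Finset.sum_sub_distrib]

theorem partialExt_nonneg (hx : ∀ v, 0 ≤ x v ∧ x v ≤ 1) (hf : ∀ S ⊆ s, 0 ≤ f S) :
    0 ≤ partialExt s f x :=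
  Finset.sum_nonneg fun S hS => mul_nonneg (hf S (Finset.mem_powerset.1 hS)) <|
    mul_nonneg (Finset.prod_nonneg fun v _ => (hx v).1)
      (Finset.prod_nonneg fun v _ => sub_nonneg.2 (hx v).2)

theorem partialExt_insert {v : V} (hv : v ∉ s) : partialExt (insert v s) f x =
    (1 - x v) * partialExt s f x + x v * partialExt s (fun S => f (insert v S)) x := by
  simp only [partialExt]
  rw [Finset.sum_powerset_insert hv, Finset.mul_sum, Finset.mul_sum]
  congr 1 <;> refine Finset.sum_congr rfl fun S hS => ?_
  all_goals
    rw [Finset.mem_powerset] at hS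
    have hvS : v ∉ S := fun h => hv (hS h)
  · rw [Finset.insert_sdiff_of_notMem _ hvS, Finset.prod_insert (by simp [hv])]
    ring
  · rw [Finset.insert_sdiff_insert, Finset.sdiff_insert_of_notMem hv, Finset.prod_insert hvS]
    ring

end partialExt

/-- The points of the unit cube. -/
def InCube {V : Type u} (x : V → ℝ) : Prop := ∀ v, 0 ≤ x v ∧ x v ≤ 1

/-- `F` is non-negative on the unit cube, and at each of its points `F` lies above a linear
function along every line of direction `e_v - e_u`, with a gradient that does not depend on
the direction. -/
def SwapConvex {V : Type u} (F : (V → ℝ) → ℝ) : Prop :=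
  (∀ x, InCube x → 0 ≤ F x) ∧ ∀ x, InCube x → ∃ g : V → ℝ, ∀ u v, u ≠ v → ∀ c : ℝ,
    F x + c * (g v - g u) ≤ F (x + c • (Pi.single v 1 - Pi.single u 1))

theorem swapConvex_multilinearExt {V : Type u} [Fintype V] {f : Finset V → ℝ}
    (hf0 : ∀ S, 0 ≤ f S) (hf : IsSubmodular f) : SwapConvex (multilinearExt f) := by
  have hext : ∀ x, multilinearExt f x = partialExt Finset.univ f x := fun x => by
    simp [multilinearExt, partialExt]
  refine ⟨fun x hx => by rw [hext]; exact partialExt_nonneg hx fun S _ => hf0 S, fun x hx => ?_⟩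
  -- The gradient entry at `v` is the partial derivative of F, the expected marginal value of `v`.
  refine ⟨fun v => partialExt (Finset.univ.erase v) (fun S => f (insert v S) - f S) x,
    fun u v huv c => ?_⟩
  set s : Finset V := (Finset.univ.erase u).erase v with hs
  have hus : u ∉ s := by simp [hs]
  have hvs : v ∉ s := by simp [hs]
  have hv : Finset.univ.erase u = insert v s := by
    rw [hs, Finset.insert_erase (by simp [huv.symm])]
  have hu : Finset.univ.erase v = insert u s := by
    rw [hs, Finset.erase_right_comm, Finset.insert_erase (by simp [huv])]
  have huniv : Finset.univ = insert u (insert v s) := by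
    rw [← hv, Finset.insert_erase (Finset.mem_univ u)]
  set y := x + c • ((Pi.single v 1 : V → ℝ) - Pi.single u 1) with hy
  have hyu : y u = x u - c := by simp [hy, huv]; ring
  have hyv : y v = x v + c := by simp [hy, huv.symm]
  have hyx : ∀ h : Finset V → ℝ, partialExt s h y = partialExt s h x := fun h => by
    refine partialExt_congr fun w hw => ?_
    have h1 : w ≠ u := fun e => hus (e ▸ hw)
    have h2 : w ≠ v := fun e => hvs (e ▸ hw)
    simp [hy, h1, h2]
  have hius : u ∉ insert v s := by simp [huv, hus]
  -- This is minus the mixed second derivative in `u` and `v`, the coefficient of `c ^ 2` along the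
  -- line.
  have hdiff : 0 ≤ partialExt s (fun S => (f (insert u S) - f S) -
      (f (insert u (insert v S)) - f (insert v S))) x := by
    refine partialExt_nonneg hx fun S hS => ?_
    have h := hf (insert u S) (insert v S)
    have h1 : insert u S ∪ insert v S = insert u (insert v S) := by
      ext w; simp; tauto
    have h2 : insert u S ∩ insert v S = S := by
      ext w
      simp only [Finset.mem_inter, Finset.mem_insert]
      constructor
      · rintro ⟨hu | hw, hv | hw'⟩
        exacts [absurd (hu.symm.trans hv) huv, hw', hw, hw]
      · exact fun h => ⟨Or.inr h, Or.inr h⟩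
    rw [h1, h2] at h
    linarith
  beta_reduce
  rw [hext, hext, hu, hv, huniv]
  simp only [partialExt_insert hius, partialExt_insert hvs, partialExt_insert hus,
    partialExt_sub, hyx, hyu, hyv, Finset.insert_comm v u] at hdiff ⊢
  nlinarith [mul_nonneg (sq_nonneg c) hdiff]

theorem multilinearExt_charVec {V : Type u} [Fintype V] (f : Finset V → ℝ) (B : Finset V) :
    multilinearExt f (charVec B) = f B := by
  rw [multilinearExt, Finset.sum_eq_single B]
  · rw [Finset.prod_congr rfl (g := fun _ => (1 : ℝ)) fun v hv => by simp [charVec, hv],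
      Finset.prod_congr (s₁ := Finset.univ \ B) rfl (g := fun _ => (1 : ℝ)) fun v hv => by
        simp [charVec, (Finset.mem_sdiff.1 hv).2]]
    simp
  · intro S _ hS
    by_cases h : S ⊆ B
    · obtain ⟨v, hvB, hvS⟩ := Finset.exists_of_ssubset (h.ssubset_of_ne hS)
      rw [Finset.prod_eq_zero (i := v) (s := Finset.univ \ S) (by simp [hvS])
        (by simp [charVec, hvB]), mul_zero, mul_zero]
    · obtain ⟨v, hvS, hvB⟩ := Finset.not_subset.1 h
      rw [Finset.prod_eq_zero hvS (by simp [charVec, hvB]), zero_mul, mul_zero]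
  · simp

/-! ### Basis exchange in matroids -/

namespace Matroid
variable {V : Type u} {M : Matroid V}

/-- Symmetric basis exchange. -/
theorem IsBase.exists_symm_exchange {X Y : Set V} (hX : M.IsBase X) (hY : M.IsBase Y) {v : V}
    (hv : v ∈ Y \ X) :
    ∃ u ∈ X \ Y, M.Indep (insert v (X \ {u})) ∧ M.Indep (insert u (Y \ {v})) := by
  have hvE := hY.subset_ground hv.1
  -- A circuit and a cocircuit never meet in exactly one element; these two share `v`, hence also
  -- some `u ≠ v`.
  obtain ⟨u, ⟨huC, huK⟩, huv⟩ := ((hX.fundCircuit_isCircuit hvE hv.2).isCocircuit_inter_nontrivial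
    (fundCocircuit_isCocircuit hv.1 hY)
    ⟨v, M.mem_fundCircuit v X, M.mem_fundCocircuit v Y⟩).exists_ne v
  have huX : u ∈ X := by simpa [huv] using M.fundCircuit_subset_insert v X huC
  have huY : u ∈ M.E \ Y := by simpa [huv] using M.fundCocircuit_subset_insert_compl v Y huK
  rw [hY.mem_fundCocircuit_iff_mem_fundCircuit,
    hY.indep.mem_fundCircuit_iff (by rw [hY.closure_eq]; exact huY.1) huY.2,
    ← Set.insert_sdiff_singleton_comm huv] at huK
  rw [hX.indep.mem_fundCircuit_iff (by rwa [hX.closure_eq]) hv.2,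
    ← Set.insert_sdiff_singleton_comm huv.symm] at huC
  exact ⟨u, ⟨huX, huY.2⟩, huC, huK⟩

/-- Both sides say that `D` meets the fundamental circuit of `v` in `X`. This is what makes binary
search possible. -/
theorem IsBase.indep_insert_sdiff_iff {X D : Set V} (hX : M.IsBase X) {v : V} (hvE : v ∈ M.E)
    (hv : v ∉ X) :
    M.Indep (insert v (X \ D)) ↔ ∃ u ∈ D, M.Indep (insert v (X \ {u})) := by
  refine ⟨fun h => ?_, fun ⟨u, hu, h⟩ => h.subset (Set.insert_subset_insert
    (Set.sdiff_subset_sdiff_right (Set.singleton_subset_iff.2 hu)))⟩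
  have hC := hX.fundCircuit_isCircuit hvE hv
  obtain ⟨u, huC, hu⟩ := Set.not_subset.1 fun hs => hC.not_indep (h.subset hs)
  have huv : u ≠ v := fun e => hu (e ▸ Set.mem_insert _ _)
  have huX : u ∈ X := by simpa [huv] using M.fundCircuit_subset_insert v X huC
  refine ⟨u, by_contra fun huD => hu (Or.inr ⟨huX, huD⟩), ?_⟩
  rwa [hX.indep.mem_fundCircuit_iff (by rwa [hX.closure_eq]) hv,
    ← Set.insert_sdiff_singleton_comm huv.symm] at huC

end Matroid

/-- Replacing `u` by `v` in `X` gives an independent set. -/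
def CanSwap {V : Type u} (M : Matroid V) (X : Finset V) (u v : V) : Prop :=
  M.Indep (insert v (X.erase u) : Finset V)

section
variable {V : Type u} {M : Matroid V} {X Y : Finset V}

theorem exists_canSwap_symm (hX : M.IsBase (X : Set V)) (hY : M.IsBase (Y : Set V)) {v : V}
    (hv : v ∈ Y \ X) : ∃ u ∈ X \ Y, CanSwap M X u v ∧ CanSwap M Y v u := by
  obtain ⟨u, hu, h1, h2⟩ := hX.exists_symm_exchange hY (v := v) (by simpa using hv)
  exact ⟨u, by simpa using hu, by simpa [CanSwap] using h1, by simpa [CanSwap] using h2⟩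

theorem indep_insert_sdiff_iff_canSwap (hE : M.E = Set.univ) (hX : M.IsBase (X : Set V)) {v : V}
    (hv : v ∉ X) {D : Finset V} :
    M.Indep (insert v (X \ D) : Finset V) ↔ ∃ u ∈ D, CanSwap M X u v := by
  have := hX.indep_insert_sdiff_iff (D := (D : Set V)) (v := v) (by simp [hE]) (by simpa using hv)
  simpa [CanSwap] using this

theorem CanSwap.isBase (hX : M.IsBase (X : Set V)) {u v : V} (hv : v ∉ X)
    (h : CanSwap M X u v) : M.IsBase (insert v (X.erase u) : Finset V) := by
  have := hX.exchange_isBase_of_indep (e := u) (f := v) (by simpa using hv)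
    (by simpa [CanSwap] using h)
  simpa using this

/-! ### Binary search and enumeration of exchanges -/

open QueryAlg

theorem QueryAlg.Sat.query_ite {α : Type u} {S : Finset V} {A A' : QueryAlg V α}
    {Q : α → ℕ → Prop} (h : M.Indep S → A.Sat (indepOracle M) fun a n => Q a (n + 1))
    (h' : ¬M.Indep S → A'.Sat (indepOracle M) fun a n => Q a (n + 1)) :
    (query S fun b => if b then A else A').Sat (indepOracle M) Q := by
  by_cases hS : M.Indep S
  · simpa [Sat, indepOracle, hS] using h hS
  · simpa [Sat, indepOracle, hS] using h' hS

/-- Binary search in a list of length at most `2 ^ k` for an element that `v` can replace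
in `X`. -/
noncomputable def binSearch (X : Finset V) (v : V) : ℕ → List V → QueryAlg V V
  | 0, L => ret (L.headD v)
  | k + 1, L => query (insert v (X \ (L.take (2 ^ k)).toFinset)) fun b =>
      if b then binSearch X v k (L.take (2 ^ k)) else binSearch X v k (L.drop (2 ^ k))

/-- Each half passed on still contains a replaceable element, so the default of `headD` is never
returned. -/
theorem sat_binSearch (hE : M.E = Set.univ) (hX : M.IsBase (X : Set V)) {v : V} (hv : v ∉ X)
    (k : ℕ) (L : List V) (hLX : ∀ u ∈ L, u ∈ X) (hL : L.length ≤ 2 ^ k)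
    (h : ∃ u ∈ L, CanSwap M X u v) :
    (binSearch X v k L).Sat (indepOracle M) fun u n => (u ∈ L ∧ CanSwap M X u v) ∧ n ≤ k := by
  induction k generalizing L with
  | zero =>
    obtain ⟨u, hu, h⟩ := h
    match L, hL with
    | [w], _ => simpa [binSearch, Sat, List.mem_singleton.1 hu] using List.mem_singleton.1 hu ▸ h
  | succ k ih =>
    have hsplit : L.take (2 ^ k) ++ L.drop (2 ^ k) = L := List.take_append_drop _ _
    have hiff := indep_insert_sdiff_iff_canSwap hE hX hv (D := (L.take (2 ^ k)).toFinset)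
    simp only [List.mem_toFinset] at hiff
    refine Sat.query_ite (fun hc => ?_) fun hc => ?_ <;> rw [hiff] at hc
    · refine (ih _ (fun u hu => hLX u (List.mem_of_mem_take hu)) (by simp) hc).mono ?_
      rintro u n ⟨⟨h1, h2⟩, h3⟩
      exact ⟨⟨List.mem_of_mem_take h1, h2⟩, by omega⟩
    · obtain ⟨w, hw, hwv⟩ := h
      refine (ih _ (fun u hu => hLX u (List.mem_of_mem_drop hu)) ?_ ⟨w, ?_, hwv⟩).mono ?_
      · rw [List.length_drop]; rw [pow_succ] at hL; omega
      · rw [← hsplit, List.mem_append] at hw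
        exact hw.resolve_left fun hw => hc ⟨w, hw, hwv⟩
      · rintro u n ⟨⟨h1, h2⟩, h3⟩
        exact ⟨⟨List.mem_of_mem_drop h1, h2⟩, by omega⟩

/-- Enumerates at most `d` elements of `L` that `v` can replace in `X`, in search of
one that can replace `v` in `Y`. -/
noncomputable def symmSearch (k : ℕ) (X Y : Finset V) (v : V) : ℕ → List V → QueryAlg V (Option V)
  | 0, _ => ret none
  | d + 1, L => (binSearch X v k L).bind fun u => query (insert u (Y.erase v)) fun b =>
      if b then ret (some u) else symmSearch k X Y v d (L.erase u)

/-- A symmetric partner is never discarded, since finding it ends the search. Every failed round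
removes one candidate, so `d` rounds suffice for at most `d` candidates. -/
theorem sat_symmSearch (hE : M.E = Set.univ) (hX : M.IsBase (X : Set V)) {v : V} (hv : v ∉ X)
    (k d : ℕ) (L : List V) (hLn : L.Nodup) (hLX : ∀ u ∈ L, u ∈ X) (hL : L.length ≤ 2 ^ k)
    (h : ∃ u ∈ L, CanSwap M X u v ∧ CanSwap M Y v u) :
    (symmSearch k X Y v d L).Sat (indepOracle M) fun o n =>
      ((∀ u ∈ o, u ∈ L ∧ CanSwap M X u v ∧ CanSwap M Y v u) ∧
        ((L.toFinset.filter fun u => CanSwap M X u v).card ≤ d → o ≠ none)) ∧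
        n ≤ d * (k + 1) := by
  induction d generalizing L with
  | zero =>
    obtain ⟨u, hu, h, -⟩ := h
    refine ⟨⟨by simp, fun h0 => ?_⟩, by simp⟩
    rw [Nat.le_zero, Finset.card_eq_zero] at h0
    exact absurd h0 (Finset.ne_empty_of_mem (Finset.mem_filter.2 ⟨List.mem_toFinset.2 hu, h⟩))
  | succ d ih =>
    obtain ⟨w, hw, hwX, hwY⟩ := h
    refine (sat_binSearch hE hX hv k L hLX hL ⟨w, hw, hwX⟩).bind ?_
    rintro u n ⟨⟨huL, hu⟩, hn⟩
    refine Sat.query_ite (fun hc : CanSwap M Y v u => ?_) fun hc : ¬CanSwap M Y v u => ?_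
    · refine ⟨⟨fun u' hu' => ?_, by simp⟩, by nlinarith⟩
      obtain rfl : u = u' := by simpa using hu'
      exact ⟨huL, hu, hc⟩
    · have hwu : w ≠ u := fun e => hc (e ▸ hwY)
      refine (ih (L.erase u) (hLn.erase u) (fun u' hu' => hLX _ (List.mem_of_mem_erase hu'))
        (List.length_erase_le.trans hL)
        ⟨w, (List.mem_erase_of_ne hwu).2 hw, hwX, hwY⟩).mono ?_
      rintro o m ⟨⟨h1, h2⟩, h3⟩
      refine ⟨⟨fun u' hu' => ⟨List.mem_of_mem_erase (h1 u' hu').1, (h1 u' hu').2⟩,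
        fun hcard => h2 ?_⟩, by nlinarith⟩
      have : (L.erase u).toFinset.filter (fun u => CanSwap M X u v) =
          (L.toFinset.filter fun u => CanSwap M X u v).erase u := by
        ext z
        simp only [Finset.mem_filter, List.mem_toFinset, Finset.mem_erase, hLn.mem_erase_iff]
        tauto
      rw [this, Finset.card_erase_of_mem (by simp [huL, hu])]
      omega

end

/-! ### Exchange cycles and random swaps -/

theorem Finset.exists_image_eq_self {V : Type*} {φ : V → V} (R : Finset V) (hR : R.Nonempty)
    (h : R.image φ ⊆ R) : ∃ Z ⊆ R, Z.Nonempty ∧ Z.image φ = Z := by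
  induction R using Finset.strongInduction with
  | H R ih =>
    by_cases he : R.image φ = R
    · exact ⟨R, subset_rfl, hR, he⟩
    · obtain ⟨Z, hZ, hZ'⟩ := ih (R.image φ) (h.ssubset_of_ne he) (hR.image φ)
        (Finset.image_subset_image h)
      exact ⟨Z, hZ.trans h, hZ'⟩

section
variable {V : Type u} {M : Matroid V} {X Y : Finset V}

open QueryAlg

/-- For the elements `u` of a list, looks for `v ∈ Y \ X` that `u` can replace in `Y` and for
`w ∈ R` that `v` can replace in `X`. The result is either some `v` for which there is no such `w`,
or the table of the pairs `(v, w)`. -/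
noncomputable def swapTable (k : ℕ) (X Y R : Finset V) : List V → QueryAlg V (V ⊕ (V → V × V))
  | [] => ret (.inr fun u => (u, u))
  | u :: l => (binSearch Y u k (Y \ X).toList).bind fun v => query (insert v (X \ R)) fun b =>
      if b then (binSearch X v k R.toList).bind fun w => (swapTable k X Y R l).bind fun o =>
        ret (o.map id fun T => Function.update T u (v, w))
      else ret (.inl v)

theorem sat_swapTable (hE : M.E = Set.univ) (hX : M.IsBase (X : Set V))
    (hY : M.IsBase (Y : Set V)) {k : ℕ} (hXk : X.card ≤ 2 ^ k) (hYk : Y.card ≤ 2 ^ k)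
    {R : Finset V} (hR : R ⊆ X \ Y) (l : List V) (hl : ∀ u ∈ l, u ∈ R) :
    (swapTable k X Y R l).Sat (indepOracle M) fun o n =>
      ((∀ v, o = .inl v → v ∈ Y \ X ∧ ∀ u ∈ R, ¬CanSwap M X u v) ∧
        ∀ T, o = .inr T → ∀ u ∈ l, (T u).1 ∈ Y \ X ∧ CanSwap M Y (T u).1 u ∧
          (T u).2 ∈ R ∧ CanSwap M X (T u).2 (T u).1) ∧ n ≤ l.length * (2 * k + 1) := by
  induction l with
  | nil => exact ⟨⟨by simp, by simp⟩, by simp⟩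
  | cons u l ih =>
    have hRX : R ⊆ X := hR.trans Finset.sdiff_subset
    have hu := hR (hl u (by simp))
    have huY : u ∉ Y := (Finset.mem_sdiff.1 hu).2
    -- Symmetric exchange with the roles of `X` and `Y` reversed shows that the search for `v`
    -- cannot fail.
    obtain ⟨v, hv, hvu, -⟩ := exists_canSwap_symm hY hX hu
    refine (sat_binSearch hE hY huY k (Y \ X).toList (fun v hv => ?_) ?_
      ⟨v, Finset.mem_toList.2 hv, hvu⟩).bind ?_
    · exact (Finset.mem_sdiff.1 (Finset.mem_toList.1 hv)).1
    · rw [Finset.length_toList]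
      exact (Finset.card_le_card Finset.sdiff_subset).trans hYk
    clear! v
    rintro v n ⟨⟨hv, hvu⟩, hn⟩
    rw [Finset.mem_toList] at hv
    have hvX : v ∉ X := (Finset.mem_sdiff.1 hv).2
    refine Sat.query_ite (fun hc => ?_) fun hc => ?_ <;>
      rw [indep_insert_sdiff_iff_canSwap hE hX hvX] at hc
    · refine (sat_binSearch hE hX hvX k R.toList (fun w hw => hRX (Finset.mem_toList.1 hw)) ?_
        (by simpa using hc)).bind ?_
      · rw [Finset.length_toList]
        exact (Finset.card_le_card hRX).trans hXk
      rintro w n' ⟨⟨hw, hwv⟩, hn'⟩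
      rw [Finset.mem_toList] at hw
      refine (ih fun u hu => hl u (List.mem_cons_of_mem _ hu)).bind ?_
      rintro o n'' ⟨⟨h1, h2⟩, hn''⟩
      refine ⟨⟨fun v' hv' => ?_, fun T hT => ?_⟩, ?_⟩
      · cases o with
        | inl z => simp only [Sum.map_inl, id, Sum.inl.injEq] at hv'; exact hv' ▸ h1 z rfl
        | inr z => simp at hv'
      · cases o with
        | inl z => simp at hT
        | inr z =>
          simp only [Sum.map_inr, Sum.inr.injEq] at hT
          subst hT
          intro u' hu'
          by_cases he : u' = u
          · subst he
            simpa using ⟨by simpa using hv, hvu, hw, hwv⟩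
          · rw [Function.update_of_ne he]
            exact h2 z rfl u' ((List.mem_cons.1 hu').resolve_left he)
      · rw [List.length_cons]; nlinarith
    · refine ⟨⟨fun v' hv' => ?_, by simp⟩, ?_⟩
      · rw [Sum.inl.injEq] at hv'
        exact hv' ▸ ⟨hv, fun w hw h => hc ⟨w, hw, h⟩⟩
      · rw [List.length_cons]; nlinarith

/-- A family of swaps between `X` and `Y` along a vertex-disjoint union of directed
cycles `φ u → σ u → u`, `u ∈ Z`, in the exchange graph. -/
structure IsExchangeCycle (M : Matroid V) (X Y Z : Finset V) (σ φ : V → V) : Prop where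
  nonempty : Z.Nonempty
  subset : Z ⊆ X \ Y
  image : Z.image φ = Z
  mem : ∀ u ∈ Z, σ u ∈ Y \ X
  left : ∀ u ∈ Z, CanSwap M X (φ u) (σ u)
  right : ∀ u ∈ Z, CanSwap M Y (σ u) u

/-- Looks for an exchange cycle within the sample `R ⊆ X \ Y`, or one of length two. -/
noncomputable def cycleSearch (k d : ℕ) (X Y R : Finset V) :
    QueryAlg V (Option (Finset V × (V → V) × (V → V))) :=
  (swapTable k X Y R R.toList).bind fun o => o.elim
    (fun v => (symmSearch k X Y v d (X \ Y).toList).bind fun o =>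
      ret (o.map fun u => ({u}, fun _ => v, id)))
    (fun T => if h : ∃ Z ⊆ R, Z.Nonempty ∧ Z.image (fun u => (T u).2) = Z
      then ret (some (h.choose, fun u => (T u).1, fun u => (T u).2)) else ret none)

/-- The sample `R` contains an element that `v` can replace, for all `v` that can replace
more than `d` elements. -/
def HitsLarge (M : Matroid V) (X Y : Finset V) (d : ℕ) (R : Finset V) : Prop :=
  ∀ v ∈ Y \ X, (∀ u ∈ R, ¬CanSwap M X u v) →
    ((X \ Y).filter fun u => CanSwap M X u v).card ≤ d

/-- Any cycle returned is valid, whatever the sample; `HitsLarge` serves only to exclude failure, by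
bounding the candidates for a `v` that misses `R`. -/
theorem sat_cycleSearch (hE : M.E = Set.univ) (hX : M.IsBase (X : Set V))
    (hY : M.IsBase (Y : Set V)) {k d : ℕ} (hXk : X.card ≤ 2 ^ k) (hYk : Y.card ≤ 2 ^ k)
    {R : Finset V} (hR : R ⊆ X \ Y) (hR0 : R.Nonempty) :
    (cycleSearch k d X Y R).Sat (indepOracle M) fun o n =>
      ((∀ c ∈ o, IsExchangeCycle M X Y c.1 c.2.1 c.2.2) ∧
        (HitsLarge M X Y d R → o ≠ none)) ∧ n ≤ R.card * (2 * k + 1) + d * (k + 1) := by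
  refine (sat_swapTable hE hX hY hXk hYk hR R.toList (by simp)).bind ?_
  rintro o n ⟨⟨h1, h2⟩, hn⟩
  rw [Finset.length_toList] at hn
  cases o with
  | inl v =>
    obtain ⟨hv, hvR⟩ := h1 v rfl
    obtain ⟨u, hu, huv⟩ := exists_canSwap_symm hX hY hv
    refine (sat_symmSearch hE hX (Y := Y) (Finset.mem_sdiff.1 hv).2 k d (X \ Y).toList
      (Finset.nodup_toList _) (fun u hu => ?_) ?_ ⟨u, Finset.mem_toList.2 hu, huv⟩).bind ?_
    · exact (Finset.mem_sdiff.1 (Finset.mem_toList.1 hu)).1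
    · rw [Finset.length_toList]
      exact (Finset.card_le_card Finset.sdiff_subset).trans hXk
    rintro o m ⟨⟨h3, h4⟩, hm⟩
    refine ⟨⟨fun c hc => ?_, fun hd => ?_⟩, by omega⟩
    · simp only [Option.mem_def, Option.map_eq_some_iff] at hc
      obtain ⟨u, hu, rfl⟩ := hc
      obtain ⟨hu, hl, hr⟩ := h3 u hu
      constructor <;> simp_all
    · simpa using h4 (by simpa using hd v hv hvR)
  | inr T =>
    have hT := h2 T rfl
    simp only [Finset.mem_toList] at hT
    have hex := Finset.exists_image_eq_self (φ := fun u => (T u).2) R hR0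
      (Finset.image_subset_iff.2 fun u hu => (hT u hu).2.2.1)
    simp only [Sum.elim_inr, dif_pos hex]
    refine ⟨⟨fun c hc => ?_, by simp⟩, by omega⟩
    obtain rfl := Option.some_injective _ hc
    obtain ⟨hZR, hZ, hZT⟩ := hex.choose_spec
    exact ⟨hZ, hZR.trans hR, hZT, fun u hu => (hT u (hZR hu)).1,
      fun u hu => (hT u (hZR hu)).2.2.2, fun u hu => (hT u (hZR hu)).2.1⟩

/-- The probability with which the swap is made in the first of two bases
of weights `a` and `b`. -/
noncomputable def swapProb (a b : ℝ) : ℝ := max 0 (min 1 (b / (a + b)))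

theorem swapProb_nonneg (a b : ℝ) : 0 ≤ swapProb a b := le_max_left _ _

theorem swapProb_le_one (a b : ℝ) : swapProb a b ≤ 1 := max_le zero_le_one (min_le_left _ _)

/-- This balance makes the expected gain of `σ u` in `X` cancel its expected loss in `Y`. -/
theorem swapProb_mul {a b : ℝ} (ha : 0 ≤ a) (hb : 0 ≤ b) :
    swapProb a b * a = (1 - swapProb a b) * b := by
  rcases (add_nonneg ha hb).eq_or_lt with h | h
  · rw [show a = 0 by linarith, show b = 0 by linarith]
    simp
  · rw [swapProb, min_eq_right ((div_le_one h).2 (by linarith)),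
      max_eq_right (div_nonneg hb h.le)]
    field_simp
    ring

/-- A uniformly random swap of an exchange cycle, in one of the two bases. -/
noncomputable def randomSwap (a b : ℝ) (X Y : Finset V) (c : Finset V × (V → V) × (V → V)) :
    QueryAlg V (Option (Finset V × Finset V)) :=
  if hc : c.1.Nonempty then uniform c.1 hc fun u =>
    coin (swapProb a b) (swapProb_nonneg a b) (swapProb_le_one a b)
      (ret (some (insert (c.2.1 u) (X.erase (c.2.2 u)), Y)))
      (ret (some (X, insert u (Y.erase (c.2.1 u)))))
  else ret none

theorem sat_randomSwap (hX : M.IsBase (X : Set V)) (hY : M.IsBase (Y : Set V)) (a b : ℝ)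
    {c : Finset V × (V → V) × (V → V)} (hc : IsExchangeCycle M X Y c.1 c.2.1 c.2.2) :
    (randomSwap a b X Y c).Sat (indepOracle M) fun o n =>
      (∀ q ∈ o, M.IsBase (q.1 : Set V) ∧ M.IsBase (q.2 : Set V) ∧
        (q.1 \ q.2).card + 1 ≤ (X \ Y).card) ∧ n ≤ 0 := by
  obtain ⟨Z, σ, φ⟩ := c
  rw [randomSwap, dif_pos hc.nonempty]
  refine Sat.uniform _ fun u hu => ?_
  have huXY := hc.subset hu
  have hwXY : φ u ∈ X \ Y := hc.subset (hc.image ▸ Finset.mem_image_of_mem φ hu)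
  have hvYX := hc.mem u hu
  simp only [Finset.mem_sdiff] at huXY hwXY hvYX
  refine Sat.coin ⟨fun q hq => ?_, le_rfl⟩ ⟨fun q hq => ?_, le_rfl⟩ <;>
    obtain rfl := Option.some_injective _ hq
  · refine ⟨(hc.left u hu).isBase hX hvYX.2, hY, ?_⟩
    have : insert (σ u) (X.erase (φ u)) \ Y = (X \ Y).erase (φ u) := by
      rw [Finset.insert_sdiff_of_mem _ hvYX.1, Finset.erase_sdiff_comm]
    simp only [this]
    exact (Finset.card_erase_add_one (Finset.mem_sdiff.2 hwXY)).le
  · refine ⟨hX, (hc.right u hu).isBase hY huXY.2, ?_⟩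
    have : X \ insert u (Y.erase (σ u)) = (X \ Y).erase u := by
      ext z
      have : z ∈ X → z ≠ σ u := fun hz e => hvYX.2 (e ▸ hz)
      simp only [Finset.mem_sdiff, Finset.mem_insert, Finset.mem_erase]
      tauto
    simp only [this]
    exact (Finset.card_erase_add_one (Finset.mem_sdiff.2 huXY)).le

theorem charVec_swap {u v : V} (hu : u ∈ X) (hv : v ∉ X) :
    charVec (insert v (X.erase u)) = charVec X + (Pi.single v 1 - Pi.single u 1) := by
  funext z
  by_cases h1 : z = v
  · subst h1
    simp [charVec, hv, show z ≠ u from fun e => hv (e ▸ hu)]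
  · by_cases h2 : z = u
    · subst h2
      simp [charVec, h1, hu]
    · simp [charVec, h1, h2]

/-- The point `y + a 1_X + b 1_Y`. -/
noncomputable def pairPoint (y : V → ℝ) (a b : ℝ) (q : Finset V × Finset V) : V → ℝ :=
  y + a • charVec q.1 + b • charVec q.2

theorem charVec_nonneg (X : Finset V) (v : V) : 0 ≤ charVec X v := by
  unfold charVec; split_ifs <;> norm_num

theorem charVec_le_one (X : Finset V) (v : V) : charVec X v ≤ 1 := by
  unfold charVec; split_ifs <;> norm_num

theorem inCube_pairPoint {y : V → ℝ} {a b : ℝ} (ha : 0 ≤ a) (hb : 0 ≤ b)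
    (hy : ∀ v, 0 ≤ y v ∧ y v + a + b ≤ 1) (q : Finset V × Finset V) :
    InCube (pairPoint y a b q) := fun v => by
  have h1 := charVec_nonneg q.1 v
  have h2 := charVec_nonneg q.2 v
  have h3 := charVec_le_one q.1 v
  have h4 := charVec_le_one q.2 v
  have := hy v
  simp only [pairPoint, Pi.add_apply, Pi.smul_apply, smul_eq_mul]
  constructor <;> nlinarith

theorem le_mean_randomSwap {F : (V → ℝ) → ℝ} (hF : SwapConvex F) {y : V → ℝ} {a b : ℝ}
    (ha : 0 ≤ a) (hb : 0 ≤ b) (hy : ∀ v, 0 ≤ y v ∧ y v + a + b ≤ 1)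
    {c : Finset V × (V → V) × (V → V)} (hc : IsExchangeCycle M X Y c.1 c.2.1 c.2.2) :
    F (pairPoint y a b (X, Y)) ≤ (randomSwap a b X Y c).mean (indepOracle M) fun o =>
      o.elim 0 fun q => F (pairPoint y a b q) := by
  obtain ⟨Z, σ, φ⟩ := c
  obtain ⟨g, hg⟩ := hF.2 _ (inCube_pairPoint ha hb hy (X, Y))
  set p := swapProb a b
  have hp := swapProb_mul ha hb
  have hp0 := swapProb_nonneg a b
  have hp1 := swapProb_le_one a b
  rw [randomSwap, dif_pos hc.nonempty, mean_uniform,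
    le_div_iff₀ (by exact_mod_cast hc.nonempty.card_pos)]
  -- The terms in `g (σ u)` from the two supporting lines cancel, by the choice of `p`.
  have hterm : ∀ u ∈ Z, F (pairPoint y a b (X, Y)) + p * a * (g u - g (φ u)) ≤
      (coin p hp0 hp1
        (ret (some (insert (σ u) (X.erase (φ u)), Y)))
        (ret (some (X, insert u (Y.erase (σ u)))))).mean (indepOracle M) fun o =>
          o.elim 0 fun q => F (pairPoint y a b q) := by
    intro u hu
    have huXY := hc.subset hu
    have hwXY : φ u ∈ X \ Y := hc.subset (hc.image ▸ Finset.mem_image_of_mem φ hu)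
    have hvYX := hc.mem u hu
    simp only [Finset.mem_sdiff] at huXY hwXY hvYX
    rw [mean_coin]
    simp only [mean, Option.elim_some]
    have h1 := hg (φ u) (σ u) (fun e => hvYX.2 (e ▸ hwXY.1)) a
    have h2 := hg (σ u) u (fun e => hvYX.2 (by rw [e]; exact huXY.1)) b
    have e1 : pairPoint y a b (insert (σ u) (X.erase (φ u)), Y) =
        pairPoint y a b (X, Y) + a • (Pi.single (σ u) 1 - Pi.single (φ u) 1) := by
      simp only [pairPoint, charVec_swap hwXY.1 hvYX.2]
      module
    have e2 : pairPoint y a b (X, insert u (Y.erase (σ u))) =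
        pairPoint y a b (X, Y) + b • (Pi.single u 1 - Pi.single (σ u) 1) := by
      simp only [pairPoint, charVec_swap hvYX.1 huXY.2]
      module
    rw [e1, e2]
    have h3 := mul_le_mul_of_nonneg_left h1 hp0
    have h4 := mul_le_mul_of_nonneg_left h2 (sub_nonneg.2 hp1)
    have h5 : (1 - p) * (b * (g u - g (σ u))) = p * a * (g u - g (σ u)) := by
      rw [hp]; ring
    change _ ≤ p * _ + (1 - p) * _
    change p * _ ≤ p * _ at h3
    change (1 - p) * _ ≤ (1 - p) * _ at h4
    linarith
  refine le_trans (le_of_eq ?_) (Finset.sum_le_sum hterm)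
  -- As `φ` permutes `Z`, the first-order terms sum to zero.
  have hinj : Set.InjOn φ Z := Finset.card_image_iff.1 (by rw [hc.image])
  have hsum : ∑ u ∈ Z, g (φ u) = ∑ u ∈ Z, g u := by
    exact (Finset.sum_image (f := g) hinj).symm.trans (by rw [hc.image])
  rw [Finset.sum_add_distrib, ← Finset.mul_sum, Finset.sum_sub_distrib, hsum, sub_self, mul_zero,
    add_zero, Finset.sum_const, nsmul_eq_mul, mul_comm]

end

/-! ### Sampling, merging and the loss from failures -/

section
variable {V : Type u} {M : Matroid V} {X Y : Finset V}

open QueryAlg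

theorem card_eq_matroidRank (hX : M.IsBase (X : Set V)) : X.card = matroidRank M := by
  rw [matroidRank, ← hX.encard_eq_eRank, Set.encard_coe_eq_coe_finsetCard, ENat.toNat_natCast]

/-- Union bound over the at most m = |X \ Y| elements `v` with more than `d` replaceable elements:
each is missed by at most (m - d)^s ≤ (e^(-d/m) m)^s samples. -/
theorem card_not_hitsLarge_le (hX : M.IsBase (X : Set V)) (hY : M.IsBase (Y : Set V))
    (s d : ℕ) :
    (((Fintype.piFinset fun _ : Fin s => X \ Y).filter fun ρ =>
      ¬HitsLarge M X Y d (Finset.univ.image ρ)).card : ℝ) ≤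
      (X \ Y).card * Real.exp (-(d * s / (X \ Y).card)) * (X \ Y).card ^ s := by
  set m := (X \ Y).card with hm
  have hcard : (Y \ X).card = m := Finset.card_sdiff_comm
    ((card_eq_matroidRank hY).trans (card_eq_matroidRank hX).symm)
  let N : V → Finset V := fun v => (X \ Y).filter fun u => CanSwap M X u v
  have hsub : ((Fintype.piFinset fun _ : Fin s => X \ Y).filter fun ρ =>
      ¬HitsLarge M X Y d (Finset.univ.image ρ)) ⊆
      ((Y \ X).filter fun v => d < (N v).card).biUnion fun v =>
        Fintype.piFinset fun _ : Fin s => (X \ Y) \ N v := by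
    intro ρ hρ
    simp only [Finset.mem_filter, Fintype.mem_piFinset, HitsLarge, not_forall, not_le] at hρ
    obtain ⟨hρ, v, hv, hvρ, hd⟩ := hρ
    refine Finset.mem_biUnion.2 ⟨v, Finset.mem_filter.2 ⟨hv, hd⟩, Fintype.mem_piFinset.2
      fun i => Finset.mem_sdiff.2 ⟨hρ i, fun h => ?_⟩⟩
    exact hvρ (ρ i) (Finset.mem_image_of_mem _ (Finset.mem_univ i)) (Finset.mem_filter.1 h).2
  have hterm : ∀ v ∈ (Y \ X).filter fun v => d < (N v).card,
      ((Fintype.piFinset fun _ : Fin s => (X \ Y) \ N v).card : ℝ) ≤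
        Real.exp (-(d * s / m)) * m ^ s := by
    intro v hv
    have hd : (d : ℝ) ≤ (N v).card := by exact_mod_cast (Finset.mem_filter.1 hv).2.le
    have hNs : N v ⊆ X \ Y := Finset.filter_subset _ _
    have hNm := Finset.card_le_card hNs
    have hm0 : (0 : ℝ) < m := by
      have := (Finset.mem_filter.1 hv).2
      exact_mod_cast lt_of_lt_of_le (by omega) hNm
    rw [Fintype.card_piFinset_const, Finset.card_sdiff_of_subset hNs, Nat.cast_pow,
      Nat.cast_sub hNm]
    have h1 : (m : ℝ) - (N v).card ≤ Real.exp (-(d / m)) * m := by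
      have h2 := Real.one_sub_le_exp_neg ((d : ℝ) / m)
      calc (m : ℝ) - (N v).card ≤ m - d := by linarith
        _ = (1 - d / m) * m := by field_simp
        _ ≤ _ := mul_le_mul_of_nonneg_right h2 hm0.le
    have h0 : (0 : ℝ) ≤ m - (N v).card := sub_nonneg.2 (by exact_mod_cast hNm)
    refine (pow_le_pow_left₀ h0 h1 s).trans (le_of_eq ?_)
    rw [mul_pow, ← Real.exp_nat_mul]
    congr 2
    ring
  calc _ ≤ ((((Y \ X).filter fun v => d < (N v).card).biUnion fun v =>
        Fintype.piFinset fun _ : Fin s => (X \ Y) \ N v).card : ℝ) := by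
          exact_mod_cast Finset.card_le_card hsub
    _ ≤ ∑ v ∈ (Y \ X).filter fun v => d < (N v).card,
        ((Fintype.piFinset fun _ : Fin s => (X \ Y) \ N v).card : ℝ) := by
          exact_mod_cast Finset.card_biUnion_le
    _ ≤ ((Y \ X).filter fun v => d < (N v).card).card * (Real.exp (-(d * s / m)) * m ^ s) := by
          rw [← nsmul_eq_mul]
          exact Finset.sum_le_card_nsmul _ _ _ hterm
    _ ≤ m * (Real.exp (-(d * s / m)) * m ^ s) := by
          gcongr
          exact_mod_cast (Finset.card_filter_le _ _).trans hcard.le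
    _ = _ := by ring

/-- One exchange step: a random swap along an exchange cycle found in a random sample
of `X \ Y`. -/
noncomputable def exchangeStep (s d k : ℕ) (a b : ℝ) (X Y : Finset V) :
    QueryAlg V (Option (Finset V × Finset V)) :=
  if h : (X \ Y).Nonempty then
    uniform (Fintype.piFinset fun _ : Fin s => X \ Y) (Fintype.piFinset_nonempty.2 fun _ => h)
      fun ρ => (cycleSearch k d X Y (Finset.univ.image ρ)).bind fun o =>
        o.elim (ret none) (randomSwap a b X Y)
  else ret none

theorem image_subset_of_mem_piFinset {s : ℕ} {U : Finset V} {ρ : Fin s → V}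
    (hρ : ρ ∈ Fintype.piFinset fun _ => U) : Finset.univ.image ρ ⊆ U :=
  Finset.image_subset_iff.2 fun i _ => Fintype.mem_piFinset.1 hρ i

theorem sat_exchangeStep (hE : M.E = Set.univ) (hX : M.IsBase (X : Set V))
    (hY : M.IsBase (Y : Set V)) {k s : ℕ} (d : ℕ) (hk : matroidRank M ≤ 2 ^ k) (hs : 0 < s)
    (a b : ℝ) :
    (exchangeStep s d k a b X Y).Sat (indepOracle M) fun o n =>
      (∀ q ∈ o, M.IsBase (q.1 : Set V) ∧ M.IsBase (q.2 : Set V) ∧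
        (q.1 \ q.2).card + 1 ≤ (X \ Y).card) ∧ n ≤ s * (2 * k + 1) + d * (k + 1) := by
  rw [exchangeStep]
  split_ifs with h
  swap
  · exact ⟨by simp, Nat.zero_le _⟩
  have : Nonempty (Fin s) := ⟨⟨0, hs⟩⟩
  refine Sat.uniform _ fun ρ hρ => (sat_cycleSearch hE hX hY
    ((card_eq_matroidRank hX).trans_le hk) ((card_eq_matroidRank hY).trans_le hk)
    (image_subset_of_mem_piFinset hρ) (Finset.univ_nonempty.image ρ)).bind ?_
  rintro o n ⟨⟨h1, -⟩, hn⟩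
  have hcard : (Finset.univ.image ρ).card * (2 * k + 1) ≤ s * (2 * k + 1) :=
    Nat.mul_le_mul_right _ (by simpa using Finset.card_image_le (s := Finset.univ) (f := ρ))
  cases o with
  | none => exact ⟨by simp, by omega⟩
  | some c =>
    refine (sat_randomSwap hX hY a b (h1 c rfl)).mono ?_
    rintro q m ⟨hq, hm⟩
    exact ⟨hq, by omega⟩

theorem le_mean_exchangeStep (hE : M.E = Set.univ) (hX : M.IsBase (X : Set V))
    (hY : M.IsBase (Y : Set V)) (hXY : X ≠ Y) {k s d : ℕ} (hk : matroidRank M ≤ 2 ^ k)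
    (hs : 0 < s) {δ : ℝ} (hδ : matroidRank M * Real.exp (-(d * s / matroidRank M)) ≤ δ)
    {F : (V → ℝ) → ℝ} (hF : SwapConvex F) {y : V → ℝ} {a b : ℝ}
    (ha : 0 ≤ a) (hb : 0 ≤ b) (hy : ∀ v, 0 ≤ y v ∧ y v + a + b ≤ 1) :
    (1 - δ) * F (pairPoint y a b (X, Y)) ≤ (exchangeStep s d k a b X Y).mean (indepOracle M)
      fun o => o.elim 0 fun q => F (pairPoint y a b q) := by
  have hXr := card_eq_matroidRank hX
  have hYr := card_eq_matroidRank hY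
  have h : (X \ Y).Nonempty := by
    rw [Finset.sdiff_nonempty]
    exact fun hs => hXY (Finset.eq_of_subset_of_card_le hs (by rw [hXr, hYr]))
  have hF0 : ∀ q, 0 ≤ F (pairPoint y a b q) := fun q => hF.1 _ (inCube_pairPoint ha hb hy q)
  have : Nonempty (Fin s) := ⟨⟨0, hs⟩⟩
  rw [exchangeStep, dif_pos h, mean_uniform]
  set P : Finset (Fin s → V) := Fintype.piFinset fun _ => X \ Y with hP
  set bad := P.filter fun ρ => ¬HitsLarge M X Y d (Finset.univ.image ρ) with hbad
  have hP0 : P.Nonempty := Fintype.piFinset_nonempty.2 fun _ => h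
  have hbadP : (bad.card : ℝ) ≤ δ * P.card := by
    have hm : (0 : ℝ) < (X \ Y).card := by exact_mod_cast h.card_pos
    have hmr : ((X \ Y).card : ℝ) ≤ matroidRank M := by
      exact_mod_cast (Finset.card_le_card Finset.sdiff_subset).trans_eq hXr
    refine (card_not_hitsLarge_le hX hY s d).trans ?_
    rw [hP, Fintype.card_piFinset_const, Nat.cast_pow]
    gcongr
    refine le_trans ?_ hδ
    gcongr
  rw [le_div_iff₀ (by exact_mod_cast hP0.card_pos)]
  -- A good sample preserves F in expectation; a bad one contributes at least 0, because F ≥ 0 and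
  -- failure counts as 0.
  have hterm : ∀ ρ ∈ P, (if HitsLarge M X Y d (Finset.univ.image ρ) then
      F (pairPoint y a b (X, Y)) else 0) ≤ ((cycleSearch k d X Y (Finset.univ.image ρ)).bind
        fun o => o.elim (ret none) (randomSwap a b X Y)).mean (indepOracle M)
        fun o => o.elim 0 fun q => F (pairPoint y a b q) := by
    intro ρ hρ
    rw [mean_bind]
    refine le_mean (sat_cycleSearch hE hX hY (hXr.trans_le hk) (hYr.trans_le hk)
      (image_subset_of_mem_piFinset hρ) (Finset.univ_nonempty.image ρ)) ?_
    rintro o n ⟨⟨h1, h2⟩, -⟩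
    cases o with
    | none =>
      rw [if_neg fun hh => h2 hh rfl]
      exact le_rfl
    | some c =>
      have := le_mean_randomSwap (M := M) hF ha hb hy (h1 c rfl)
      split_ifs
      · exact this
      · exact (hF0 _).trans this
  refine le_trans ?_ (Finset.sum_le_sum hterm)
  rw [← Finset.sum_filter, Finset.sum_const, nsmul_eq_mul]
  have hsplit := Finset.card_filter_add_card_filter_not (s := P)
    (fun ρ => HitsLarge M X Y d (Finset.univ.image ρ))
  have hsplit' : ((P.filter fun ρ => HitsLarge M X Y d (Finset.univ.image ρ)).card : ℝ) +
      bad.card = P.card := by exact_mod_cast hsplit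
  nlinarith [hF0 (X, Y)]

/-- Merges two bases of weights `a` and `b` by at most `n` exchange steps. -/
noncomputable def mergeBases (s d k : ℕ) (a b : ℝ) :
    ℕ → Finset V → Finset V → QueryAlg V (Option (Finset V))
  | 0, X, _ => ret (some X)
  | n + 1, X, Y => if X = Y then ret (some X) else
      (exchangeStep s d k a b X Y).bind fun o =>
        o.elim (ret none) fun q => mergeBases s d k a b n q.1 q.2

theorem sat_mergeBases (hE : M.E = Set.univ) {k s : ℕ} (d : ℕ) (hk : matroidRank M ≤ 2 ^ k)
    (hs : 0 < s) (a b : ℝ) (n : ℕ) (hX : M.IsBase (X : Set V)) (hY : M.IsBase (Y : Set V)) :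
    (mergeBases s d k a b n X Y).Sat (indepOracle M) fun o m =>
      (∀ Z ∈ o, M.IsBase (Z : Set V)) ∧ m ≤ n * (s * (2 * k + 1) + d * (k + 1)) := by
  induction n generalizing X Y with
  | zero => exact ⟨fun Z hZ => Option.some_injective _ hZ ▸ hX, Nat.zero_le _⟩
  | succ n ih =>
    rw [mergeBases]
    split_ifs with h
    · exact ⟨fun Z hZ => Option.some_injective _ hZ ▸ hX, Nat.zero_le _⟩
    refine (sat_exchangeStep hE hX hY d hk hs a b).bind ?_
    rintro o m ⟨h1, hm⟩
    cases o with
    | none => exact ⟨by simp, by rw [add_mul]; omega⟩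
    | some q =>
      obtain ⟨hq1, hq2, -⟩ := h1 q rfl
      refine (ih hq1 hq2).mono ?_
      rintro o m' ⟨h2, hm'⟩
      exact ⟨h2, by rw [add_mul]; omega⟩

/-- Every successful step shrinks `X \ Y`, so the bases agree when the `n` steps run out. The offset
`y` carries the bases not yet merged. -/
theorem le_mean_mergeBases (hE : M.E = Set.univ) {k s d : ℕ} (hk : matroidRank M ≤ 2 ^ k)
    (hs : 0 < s) {δ : ℝ} (hδ : matroidRank M * Real.exp (-(d * s / matroidRank M)) ≤ δ)
    (hδ1 : δ ≤ 1) {F : (V → ℝ) → ℝ} (hF : SwapConvex F) {y : V → ℝ} {a b : ℝ}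
    (ha : 0 ≤ a) (hb : 0 ≤ b) (hy : ∀ v, 0 ≤ y v ∧ y v + a + b ≤ 1) (n : ℕ)
    (hX : M.IsBase (X : Set V)) (hY : M.IsBase (Y : Set V)) (hn : (X \ Y).card ≤ n) :
    (1 - δ) ^ n * F (pairPoint y a b (X, Y)) ≤
      (mergeBases s d k a b n X Y).mean (indepOracle M)
        fun o => o.elim 0 fun Z => F (pairPoint y a b (Z, Z)) := by
  have hF0 : ∀ q, 0 ≤ F (pairPoint y a b q) := fun q => hF.1 _ (inCube_pairPoint ha hb hy q)
  have hδ0 : 0 ≤ δ := le_trans (by positivity) hδ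
  induction n generalizing X Y with
  | zero =>
    have hXY : X = Y := Finset.eq_of_subset_of_card_le
      (Finset.sdiff_eq_empty_iff_subset.1 (Finset.card_eq_zero.1 (Nat.le_zero.1 hn)))
      (by rw [card_eq_matroidRank hX, card_eq_matroidRank hY])
    subst hXY
    simp [mergeBases, mean]
  | succ n ih =>
    rw [mergeBases]
    split_ifs with h
    · subst h
      simpa [mean] using mul_le_of_le_one_left (hF0 _)
        (pow_le_one₀ (sub_nonneg.2 hδ1) (by linarith))
    rw [mean_bind]
    refine le_trans ?_ (mean_mono (sat_exchangeStep hE hX hY d hk hs a b)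
      (g := fun o => (1 - δ) ^ n * o.elim 0 fun q => F (pairPoint y a b q)) ?_)
    · rw [mean_const_mul, pow_succ, mul_assoc]
      exact mul_le_mul_of_nonneg_left (le_mean_exchangeStep hE hX hY h hk hs hδ hF ha hb hy)
        (pow_nonneg (sub_nonneg.2 hδ1) n)
    · rintro o m ⟨h1, -⟩
      cases o with
      | none => simp [mean]
      | some q =>
        obtain ⟨hq1, hq2, hq⟩ := h1 q rfl
        exact ih hq1 hq2 (by omega)

/-- Merges a list of weighted bases into the base `X` of weight `a`. -/
noncomputable def mergeList (s d k r : ℕ) :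
    ℝ → Finset V → List (ℝ × Finset V) → QueryAlg V (Option (Finset V))
  | _, X, [] => ret (some X)
  | a, X, q :: l => (mergeBases s d k a q.1 r X q.2).bind fun o =>
      o.elim (ret none) fun Z => mergeList s d k r (a + q.1) Z l

/-- The linear combination of characteristic vectors given by a list. -/
noncomputable def listPoint (l : List (ℝ × Finset V)) : V → ℝ :=
  (l.map fun q => q.1 • charVec q.2).sum

theorem listPoint_cons (q : ℝ × Finset V) (l : List (ℝ × Finset V)) :
    listPoint (q :: l) = q.1 • charVec q.2 + listPoint l := by
  simp [listPoint]

theorem listPoint_mem_Icc (l : List (ℝ × Finset V)) (hl : ∀ q ∈ l, 0 ≤ q.1) (v : V) :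
    0 ≤ listPoint l v ∧ listPoint l v ≤ (l.map Prod.fst).sum := by
  induction l with
  | nil => simp [listPoint]
  | cons q l ih =>
    have h := ih fun q hq => hl q (List.mem_cons_of_mem _ hq)
    have hq := hl q (by simp)
    have h0 := charVec_nonneg q.2 v
    have h1 := charVec_le_one q.2 v
    simp only [listPoint_cons, Pi.add_apply, Pi.smul_apply, smul_eq_mul, List.map_cons,
      List.sum_cons]
    constructor <;> nlinarith

theorem sat_mergeList (hE : M.E = Set.univ) {k s : ℕ} (d : ℕ) (hk : matroidRank M ≤ 2 ^ k)
    (hs : 0 < s) (r : ℕ) (a : ℝ) (hX : M.IsBase (X : Set V)) (l : List (ℝ × Finset V))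
    (hl : ∀ q ∈ l, M.IsBase (q.2 : Set V)) :
    (mergeList s d k r a X l).Sat (indepOracle M) fun o m =>
      (∀ Z ∈ o, M.IsBase (Z : Set V)) ∧
        m ≤ r * l.length * (s * (2 * k + 1) + d * (k + 1)) := by
  induction l generalizing a X with
  | nil => exact ⟨fun Z hZ => Option.some_injective _ hZ ▸ hX, Nat.zero_le _⟩
  | cons q l ih =>
    refine (sat_mergeBases hE d hk hs a q.1 r hX (hl q (by simp))).bind ?_
    rintro o m ⟨h1, hm⟩
    cases o with
    | none => exact ⟨by simp, by rw [List.length_cons, mul_add r, mul_one, add_mul (r * l.length)]; omega⟩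
    | some Z =>
      refine (ih (a + q.1) (h1 Z rfl) fun q hq => hl q (List.mem_cons_of_mem _ hq)).mono ?_
      rintro o m' ⟨h2, hm'⟩
      exact ⟨h2, by rw [List.length_cons, mul_add r, mul_one, add_mul (r * l.length)]; omega⟩

theorem le_mean_mergeList (hE : M.E = Set.univ) {k s d : ℕ} (hk : matroidRank M ≤ 2 ^ k)
    (hs : 0 < s) {δ : ℝ} (hδ : matroidRank M * Real.exp (-(d * s / matroidRank M)) ≤ δ)
    (hδ1 : δ ≤ 1) {F : (V → ℝ) → ℝ} (hF : SwapConvex F) {a : ℝ} (ha : 0 ≤ a)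
    (hX : M.IsBase (X : Set V)) (l : List (ℝ × Finset V))
    (hl : ∀ q ∈ l, M.IsBase (q.2 : Set V)) (hl0 : ∀ q ∈ l, 0 ≤ q.1)
    (hsum : a + (l.map Prod.fst).sum = 1) :
    (1 - δ) ^ (matroidRank M * l.length) * F (a • charVec X + listPoint l) ≤
      (mergeList s d k (matroidRank M) a X l).mean (indepOracle M)
        fun o => o.elim 0 fun Z => F (charVec Z) := by
  induction l generalizing a X with
  | nil =>
    obtain rfl : a = 1 := by simpa using hsum
    simp [mergeList, mean, listPoint]
  | cons q l ih =>
    have hq := hl q (by simp)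
    have hq0 := hl0 q (by simp)
    have hl' : ∀ q ∈ l, M.IsBase (q.2 : Set V) := fun q hq => hl q (List.mem_cons_of_mem _ hq)
    have hl0' : ∀ q ∈ l, 0 ≤ q.1 := fun q hq => hl0 q (List.mem_cons_of_mem _ hq)
    have hsum' : a + q.1 + (l.map Prod.fst).sum = 1 := by
      rw [← hsum, List.map_cons, List.sum_cons, add_assoc]
    have hy : ∀ v, 0 ≤ listPoint l v ∧ listPoint l v + a + q.1 ≤ 1 := fun v => by
      have := listPoint_mem_Icc l hl0' v
      exact ⟨this.1, by linarith⟩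
    have hmerge := le_mean_mergeBases hE hk hs hδ hδ1 hF ha hq0 hy (matroidRank M) hX hq
      ((Finset.card_le_card Finset.sdiff_subset).trans_eq (card_eq_matroidRank hX))
    rw [mergeList, mean_bind]
    refine le_trans ?_ (mean_mono (sat_mergeBases hE d hk hs a q.1 (matroidRank M) hX hq)
      (g := fun o => (1 - δ) ^ (matroidRank M * l.length) *
        o.elim 0 fun Z => F (pairPoint (listPoint l) a q.1 (Z, Z))) ?_)
    · rw [mean_const_mul, List.length_cons, mul_add, mul_one, pow_add, mul_assoc]
      refine mul_le_mul_of_nonneg_left (le_trans (le_of_eq ?_) hmerge)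
        (pow_nonneg (sub_nonneg.2 hδ1) _)
      congr 2
      simp only [listPoint_cons, pairPoint]
      abel
    · rintro o m ⟨h1, -⟩
      cases o with
      | none => simp [mean]
      | some Z =>
        refine le_trans (le_of_eq ?_) (ih (add_nonneg ha hq0) (h1 Z rfl) hl' hl0' hsum')
        simp only [Option.elim_some, pairPoint]
        congr 2
        module

/-! ### Choice of parameters and the query bound -/

/-- The size of the random samples. -/
noncomputable def sampleSize (ε : ℝ) (r t : ℕ) : ℕ :=
  ⌈√(2 * (r * Real.posLog (r * t / ε)))⌉₊ + 1

theorem sampleSize_pos (ε : ℝ) (r t : ℕ) : 0 < sampleSize ε r t := Nat.succ_pos _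

theorem le_two_pow_log_add_one (r : ℕ) : r ≤ 2 ^ (Nat.log 2 r + 1) :=
  (Nat.lt_pow_succ_log_self one_lt_two r).le

theorem mul_exp_sampleSize_le {ε : ℝ} (hε : 0 < ε) (hε1 : ε < 1) (r : ℕ) {t : ℕ} (ht : 1 ≤ t) :
    r * Real.exp (-((sampleSize ε r t : ℕ) * (sampleSize ε r t : ℕ) / r)) ≤ ε / (r * t) := by
  rcases Nat.eq_zero_or_pos r with rfl | hr
  · simp
  have hr' : (0 : ℝ) < r := by exact_mod_cast hr
  have ht' : (1 : ℝ) ≤ t := by exact_mod_cast ht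
  have hz : (0 : ℝ) < r * t / ε := by positivity
  set Λ := Real.posLog (r * t / ε) with hΛ
  have hΛ0 : 0 ≤ Λ := Real.posLog_nonneg
  have hs : 2 * (r * Λ) ≤ (sampleSize ε r t : ℝ) * sampleSize ε r t := by
    have h1 : √(2 * (r * Λ)) ≤ sampleSize ε r t := by
      rw [sampleSize, Nat.cast_add, Nat.cast_one]
      exact (Nat.le_ceil _).trans (by linarith)
    calc 2 * (r * Λ) = √(2 * (r * Λ)) * √(2 * (r * Λ)) :=
          (Real.mul_self_sqrt (by positivity)).symm
      _ ≤ _ := mul_self_le_mul_self (Real.sqrt_nonneg _) h1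
  have h2 : 2 * Λ ≤ (sampleSize ε r t : ℝ) * sampleSize ε r t / r := by
    rw [le_div_iff₀ hr']; linarith
  have h3 : Real.exp (-Λ) ≤ ε / (r * t) := by
    have : Real.log (r * t / ε) ≤ Λ := le_max_right _ _
    calc Real.exp (-Λ) ≤ Real.exp (-Real.log (r * t / ε)) :=
          Real.exp_le_exp.2 (neg_le_neg this)
      _ = ε / (r * t) := by rw [Real.exp_neg, Real.exp_log hz, inv_div]
  calc r * Real.exp (-((sampleSize ε r t : ℝ) * (sampleSize ε r t) / r))
      ≤ r * Real.exp (-(2 * Λ)) := by gcongr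
    _ = r * (Real.exp (-Λ) * Real.exp (-Λ)) := by rw [← Real.exp_add]; ring_nf
    -- The factor 2 in the sample size yields the square; its second factor absorbs the `r` of the
    -- union bound.
    _ ≤ r * (ε / (r * t) * (ε / (r * t))) := by gcongr
    _ = ε / (r * t) * (ε / t) := by field_simp
    _ ≤ ε / (r * t) * 1 := by
        gcongr
        rw [div_le_one (by linarith)]
        linarith
    _ = _ := mul_one _

theorem sampleSize_cost_le {ε : ℝ} (hε : 0 < ε) (hε1 : ε < 1) (r l : ℕ) :
    ((r * l * (sampleSize ε r (l + 1) * (2 * (Nat.log 2 r + 1) + 1) +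
      sampleSize ε r (l + 1) * (Nat.log 2 r + 1 + 1)) : ℕ) : ℝ) ≤
    60 * ((r : ℝ) ^ (3 / 2 : ℝ) * ((l + 1 : ℕ) : ℝ) *
      (Real.posLog ((r : ℝ) * ((l + 1 : ℕ) : ℝ) / ε)) ^ (3 / 2 : ℝ)) := by
  have hΛ0 : 0 ≤ Real.posLog ((r : ℝ) * ((l + 1 : ℕ) : ℝ) / ε) := Real.posLog_nonneg
  rcases Nat.eq_zero_or_pos r with rfl | hr
  · simp
  -- A single base needs no queries. With two or more, `rt/ε ≥ 2r` keeps the logarithm at least `log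
  -- 2`.
  rcases Nat.eq_zero_or_pos l with rfl | hl
  · rw [Nat.mul_zero, Nat.zero_mul, Nat.cast_zero]
    positivity
  have hr' : (1 : ℝ) ≤ r := by exact_mod_cast hr
  have ht' : (2 : ℝ) ≤ ((l + 1 : ℕ) : ℝ) := by exact_mod_cast Nat.succ_le_succ hl
  have hz : (r : ℝ) * 2 ≤ r * ((l + 1 : ℕ) : ℝ) / ε := by
    rw [le_div_iff₀ hε]
    nlinarith
  have hs : (sampleSize ε r (l + 1) : ℝ) ≤
      √(2 * (r * Real.posLog (r * ((l + 1 : ℕ) : ℝ) / ε))) + 2 := by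
    rw [sampleSize, Nat.cast_add, Nat.cast_one]
    linarith [Nat.ceil_lt_add_one (Real.sqrt_nonneg
      (2 * ((r : ℝ) * Real.posLog (r * ((l + 1 : ℕ) : ℝ) / ε))))]
  set s : ℝ := (sampleSize ε r (l + 1) : ℝ) with hsdef
  set Λ := Real.posLog ((r : ℝ) * ((l + 1 : ℕ) : ℝ) / ε) with hΛ
  have hlog : Real.log (r * 2) ≤ Λ :=
    (Real.log_le_log (by positivity) hz).trans (le_max_right _ _)
  have hlog2 := Real.log_two_gt_d9
  rw [Real.log_mul (by positivity) (by norm_num)] at hlog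
  have hk : ((Nat.log 2 r + 1 : ℕ) : ℝ) ≤ 3 * Λ := by
    have h1 : (Nat.log 2 r : ℝ) ≤ Real.logb 2 r := by
      exact_mod_cast Real.natLog_le_logb r 2
    rw [Real.logb, le_div_iff₀ (by linarith)] at h1
    push_cast
    nlinarith [Nat.cast_nonneg (α := ℝ) (Nat.log 2 r)]
  have hk1 : (1 : ℝ) ≤ ((Nat.log 2 r + 1 : ℕ) : ℝ) := by exact_mod_cast Nat.le_add_left 1 _
  set q := √(r * Λ) with hq
  have hΛ69 : 0.69 ≤ Λ := by linarith [Real.log_nonneg hr']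
  have hq8 : 0.8 ≤ q := Real.le_sqrt_of_sq_le (by nlinarith)
  -- `s ≤ 1.5 q + 2`, and `2 ≤ 2.5 q` because `q ≥ 0.8`.
  have hs4 : s ≤ 4 * q := by
    have h2 : √2 ≤ 1.5 := by rw [Real.sqrt_le_left (by norm_num)]; norm_num
    rw [Real.sqrt_mul (by norm_num)] at hs
    nlinarith
  have hpow : (r : ℝ) ^ (3 / 2 : ℝ) * Λ ^ (3 / 2 : ℝ) = r * Λ * q := by
    rw [← Real.mul_rpow (by positivity) hΛ0, hq, Real.sqrt_eq_rpow,
      show (3 / 2 : ℝ) = 1 + 1 / 2 by norm_num, Real.rpow_add (by positivity), Real.rpow_one]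
  have hs0 : 0 ≤ s := Nat.cast_nonneg _
  have hsk : s * ((Nat.log 2 r + 1 : ℕ) : ℝ) ≤ 4 * q * (3 * Λ) := by gcongr
  calc _ = (r : ℝ) * l * (s * (3 * ((Nat.log 2 r + 1 : ℕ) : ℝ) + 2)) := by
        push_cast; ring
    -- With k = `Nat.log 2 r + 1` ≥ 1, `3k + 2 ≤ 5k`; hence the constant 60 = 5 · 4 · 3.
    _ ≤ (r : ℝ) * ((l + 1 : ℕ) : ℝ) * (5 * (4 * q * (3 * Λ))) := by
        have hl' : (l : ℝ) ≤ ((l + 1 : ℕ) : ℝ) := by exact_mod_cast Nat.le_succ l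
        exact mul_le_mul (by gcongr) (by nlinarith) (by positivity) (by positivity)
    _ = 60 * ((l + 1 : ℕ) : ℝ) * (r * Λ * q) := by ring
    _ = _ := by rw [← hpow]; ring

/-! ### The rounding algorithm -/

/-- The rounding algorithm, for a list of weighted bases. -/
noncomputable def roundList (ε : ℝ) : List (ℝ × Finset V) → QueryAlg V (Finset V)
  | [] => ret ∅
  | q :: l => if 1 ≤ ε then ret q.2 else
      (mergeList (sampleSize ε q.2.card (l.length + 1)) (sampleSize ε q.2.card (l.length + 1))
        (Nat.log 2 q.2.card + 1) q.2.card q.1 q.2 l).bind fun o => ret (o.getD q.2)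

theorem sat_roundList (hE : M.E = Set.univ) {ε : ℝ} (hε : 0 < ε) (L : List (ℝ × Finset V))
    (hL0 : L ≠ []) (hL : ∀ q ∈ L, M.IsBase (q.2 : Set V)) :
    (roundList ε L).Sat (indepOracle M) fun S n => M.IsBase (S : Set V) ∧
      (n : ℝ) ≤ 60 * ((matroidRank M : ℝ) ^ (3 / 2 : ℝ) * (L.length : ℝ) *
        (Real.posLog ((matroidRank M : ℝ) * (L.length : ℝ) / ε)) ^ (3 / 2 : ℝ)) := by
  match L with
  | [] => exact absurd rfl hL0
  | q :: l =>
    have hq := hL q (by simp)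
    rw [roundList, card_eq_matroidRank hq]
    split_ifs with h1
    · refine ⟨hq, ?_⟩
      have := Real.posLog_nonneg (x := (matroidRank M : ℝ) * ((q :: l).length : ℝ) / ε)
      rw [Nat.cast_zero]
      positivity
    refine (sat_mergeList hE _ (le_two_pow_log_add_one _) (sampleSize_pos _ _ _) _ q.1
      hq l fun q hq => hL q (List.mem_cons_of_mem _ hq)).bind ?_
    rintro o n ⟨ho, hn⟩
    refine ⟨?_, ?_⟩
    · cases o with
      | none => exact hq
      | some Z => exact ho Z rfl
    · rw [add_zero, List.length_cons]
      exact le_trans (Nat.cast_le.2 hn) (sampleSize_cost_le hε (not_le.1 h1) _ _)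

theorem le_mean_roundList [Fintype V] (hE : M.E = Set.univ) {ε : ℝ} (hε : 0 < ε)
    (L : List (ℝ × Finset V)) (hL0 : L ≠ []) (hL : ∀ q ∈ L, M.IsBase (q.2 : Set V))
    (hLn : ∀ q ∈ L, 0 ≤ q.1) (hLs : (L.map Prod.fst).sum = 1) {f : Finset V → ℝ}
    (hf0 : ∀ S, 0 ≤ f S) (hf : IsSubmodular f) :
    (1 - ε) * multilinearExt f (listPoint L) ≤ (roundList ε L).mean (indepOracle M) f := by
  have hF := swapConvex_multilinearExt hf0 hf
  have hcube : InCube (listPoint L) := fun v => hLs ▸ listPoint_mem_Icc L hLn v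
  match L with
  | [] => exact absurd rfl hL0
  | q :: l =>
    have hq := hL q (by simp)
    rw [roundList, card_eq_matroidRank hq]
    split_ifs with h1
    · exact (mul_nonpos_of_nonpos_of_nonneg (by linarith) (hF.1 _ hcube)).trans (hf0 _)
    have hδ := mul_exp_sampleSize_le hε (not_le.1 h1) (matroidRank M)
      (Nat.le_add_left 1 l.length)
    set δ := ε / ((matroidRank M : ℝ) * ((l.length + 1 : ℕ) : ℝ)) with hδdef
    have hδ0 : 0 ≤ δ := by positivity
    -- In rank zero the division by zero makes `δ = 0`.
    have hδr : δ * (matroidRank M * l.length) ≤ ε := by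
      rcases Nat.eq_zero_or_pos (matroidRank M) with h0 | h0
      · simp [h0, hε.le]
      · have h0' : (0 : ℝ) < matroidRank M := by exact_mod_cast h0
        rw [hδdef, div_mul_eq_mul_div, div_le_iff₀ (by positivity)]
        gcongr
        exact Nat.le_succ _
    have hδ1 : δ ≤ 1 := by
      rcases Nat.eq_zero_or_pos (matroidRank M) with h0 | h0
      · simp [hδdef, h0]
      · have h0' : (1 : ℝ) ≤ matroidRank M := by exact_mod_cast h0
        have h2 : (1 : ℝ) ≤ ((l.length + 1 : ℕ) : ℝ) := by exact_mod_cast Nat.le_add_left 1 _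
        rw [hδdef, div_le_one (by positivity)]
        nlinarith
    -- Bernoulli's inequality over all exchange steps.
    have hbern : 1 - ε ≤ (1 - δ) ^ (matroidRank M * l.length) := by
      have := one_add_mul_le_pow (a := -δ) (by linarith) (matroidRank M * l.length)
      rw [← sub_eq_add_neg 1 δ] at this
      push_cast at this
      linarith
    have hm := le_mean_mergeList hE (le_two_pow_log_add_one _)
      (sampleSize_pos _ _ _) hδ hδ1 hF (hLn q (by simp)) hq l
      (fun q hq => hL q (List.mem_cons_of_mem _ hq))
      (fun q hq => hLn q (List.mem_cons_of_mem _ hq)) (by simpa using hLs)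
    rw [mean_bind]
    refine (mul_le_mul_of_nonneg_right hbern (hF.1 _ hcube)).trans ?_
    rw [listPoint_cons]
    refine hm.trans (mean_mono (sat_mergeList hE _ (le_two_pow_log_add_one _)
      (sampleSize_pos _ _ _) _ q.1 hq l fun q hq => hL q (List.mem_cons_of_mem _ hq)) ?_)
    rintro o n -
    cases o with
    -- After a failure the first base is returned, and its value is at least the 0 counted so far.
    | none => exact hf0 _
    | some Z => exact (multilinearExt_charVec f Z).le

end

theorem theorem1p2 :
    ∃ C : ℝ, 0 < C ∧ ∀ ε : ℝ, 0 < ε →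
      -- the algorithm: it sees the ground set, the bases and the coefficients
      ∃ Alg : (V : Type u) → [Fintype V] → (t : ℕ) → (Fin t → Finset V) → (Fin t → ℝ) →
          QueryAlg V (Finset V),
        ∀ (V : Type u) [Fintype V] (M : Matroid V), M.E = Set.univ →
        ∀ (t : ℕ) (B : Fin t → Finset V) (β : Fin t → ℝ),
          (∀ i, M.IsBase (B i : Set V)) → (∀ i, 0 ≤ β i) → ∑ i, β i = 1 →
        ∀ x : V → ℝ, x = ∑ i, β i • charVec (B i) →
          (∀ S ∈ ((Alg V t B β).output (indepOracle M)).support, M.IsBase (S : Set V)) ∧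
          (∀ f : Finset V → ℝ, (∀ S, 0 ≤ f S) → IsSubmodular f →
            (1 - ε) * multilinearExt f x ≤
              expect ((Alg V t B β).output (indepOracle M)) f) ∧
          (∀ z ∈ ((Alg V t B β).run (indepOracle M)).support,
            (z.2 : ℝ) ≤ C * ((matroidRank M : ℝ) ^ (3 / 2 : ℝ) * (t : ℝ) *
              (Real.posLog ((matroidRank M : ℝ) * (t : ℝ) / ε)) ^ (3 / 2 : ℝ))) := by
  refine ⟨60, by norm_num, fun ε hε =>
    ⟨fun V _ t B β => roundList ε (List.ofFn fun i => (β i, B i)), ?_⟩⟩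
  rintro V _ M hE t B β hB hβ hsum x rfl
  have hL0 : List.ofFn (fun i => (β i, B i)) ≠ [] := by
    intro h
    rw [List.ofFn_eq_nil_iff] at h
    subst h
    simp at hsum
  have hL : ∀ q ∈ List.ofFn (fun i => (β i, B i)), M.IsBase (q.2 : Set V) := by
    simpa [List.mem_ofFn] using hB
  have hLn : ∀ q ∈ List.ofFn (fun i => (β i, B i)), 0 ≤ q.1 := by
    simpa [List.mem_ofFn] using hβ
  have hLs : ((List.ofFn fun i => (β i, B i)).map Prod.fst).sum = 1 := by
    rw [List.map_ofFn, List.sum_ofFn]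
    exact hsum
  have hx : listPoint (List.ofFn fun i => (β i, B i)) = ∑ i, β i • charVec (B i) := by
    rw [listPoint, List.map_ofFn, List.sum_ofFn]
    rfl
  have hsat := (sat_roundList hE hε _ hL0 hL).of_mem_support
  rw [List.length_ofFn] at hsat
  refine ⟨fun S hS => ?_, fun f hf0 hf => ?_, fun z hz => (hsat z hz).2⟩
  · rw [QueryAlg.output, PMF.support_map] at hS
    obtain ⟨z, hz, rfl⟩ := hS
    exact (hsat z hz).1
  · rw [QueryAlg.expect_output, ← hx]
    exact le_mean_roundList hE hε _ hL0 hL hLn hLs hf0 hf
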